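/- Let $\mathbb F$ be a field, and let $P$ and $Q$ be finite ranked posets, each with a unique minimal element, where a rank function on a poset is a map $\rho$ to $\mathbb N$ such that $\rho(p)=0$ if and only if $p$ is minimal, and $\rho(q)=\rho(p)+1$ whenever $q$ covers $p$ (written $p\lessdot q$). Put $$\mathcal M_P(z)=\sum_{p\le q\text{ in }P}\mu(p,q)\,z^{\rho(q)-\rho(p)},$$ where $\mu$ is the Möbius function of $P$, and define $\mathcal M_Q(z)$ likewise. For a finite ranked poset $S$, let $E_S=\{(q,p): p\lessdot q\}$ be the set of edges of its Hasse diagram, the edge $(q,p)$ having tail $q$ and head $p$. A path is a sequence $\pi=(e_1,\dots,e_n)$ of edges, $n\ge 1$, such that the head of $e_i$ is the tail of $e_{i+1}$ for $1\le i<n$; its tail is the tail of $e_1$ and its head is the head of $e_n$. Let $\mathbb F\langle E_S\rangle$ be the free associative algebra on $E_S$, and for each path $\pi$ write $$(t-e_1)(t-e_2)\cdots(t-e_n)=\sum_{i\ge 0}e(\pi,i)\,t^i\in\mathbb F\langle E_S\rangle[t],$$ where $t$ is a central variable. The splitting algebra $A(S)$ is the quotient of $\mathbb F\langle E_S\rangle$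 by the two-sided ideal generated by all $e(\pi_1,i)-e(\pi_2,i)$, where $i\ge 0$ and $\pi_1,\pi_2$ are paths with the same tail and the same head. It is graded by the images $A(S)_n$ of the spans of the words of length $n$, and its Hilbert series is $H(A(S),z)=\sum_{n\ge 0}\dim_{\mathbb F}(A(S)_n)\,z^n$. Let $P\times Q$ carry the componentwise order and the rank function that is the sum of the two rank functions. Then, as formal power series, $$H(A(P\times Q),z)=\frac{1-z}{1-z\,\mathcal M_P(z)\,\mathcal M_Q(z)}.$$ -/

import Mathlib

open Polynomial PowerSeries

noncomputable section

namespace SplittingAlgebra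

/-- Rank functions on a poset: `ρ p = 0` exactly for the minimal elements `p`, and `ρ` increases
by one along every covering relation. -/
structure IsRankFunction {P : Type*} [PartialOrder P] (ρ : P → ℕ) : Prop where
  eq_zero_iff : ∀ p : P, ρ p = 0 ↔ IsMin p
  covBy : ∀ p q : P, p ⋖ q → ρ q = ρ p + 1

/-- The Möbius polynomial `∑_{p ≤ q} μ(p,q) z^{ρ(q) - ρ(p)}`. -/
def mobiusPolynomial {P : Type*} [PartialOrder P] [Fintype P] [DecidableEq P]
    [LocallyFiniteOrder P] (ρ : P → ℕ) : ℤ[X] :=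
  open Classical in
  ∑ x : P × P with x.1 ≤ x.2,
    Polynomial.C (IncidenceAlgebra.mu ℤ (α := P) x.1 x.2) * Polynomial.X ^ (ρ x.2 - ρ x.1)

/-- The edges of the Hasse diagram of `P`: the pairs `(q, p)` with `p ⋖ q`, directed from the tail
`q` to the head `p`. -/
def HasseEdge (P : Type*) [PartialOrder P] : Type _ := {e : P × P // e.2 ⋖ e.1}

/-- The tail of the edge `(q, p)` is `q`. -/
def HasseEdge.tail {P : Type*} [PartialOrder P] (e : HasseEdge P) : P := e.1.1

/-- The head of the edge `(q, p)` is `p`. -/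
def HasseEdge.head {P : Type*} [PartialOrder P] (e : HasseEdge P) : P := e.1.2

/-- Paths `(e₁, …, eₙ)`, `n ≥ 1`, in the Hasse diagram: the head of each edge is the tail of the
next one. -/
structure HassePath (P : Type*) [PartialOrder P] where
  edges : List (HasseEdge P)
  ne_nil : edges ≠ []
  isChain : edges.IsChain (fun e f => e.head = f.tail)

/-- The tail of a path is the tail of its first edge. -/
def HassePath.tail {P : Type*} [PartialOrder P] (π : HassePath P) : P :=
  (π.edges.head π.ne_nil).tail

/-- The head of a path is the head of its last edge. -/
def HassePath.head {P : Type*} [PartialOrder P] (π : HassePath P) : P :=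
  (π.edges.getLast π.ne_nil).head

/-- The polynomial `(t - e₁)(t - e₂)⋯(t - eₙ)` of a path, over the free algebra on the edges; the
variable `t` is central. -/
def HassePath.poly (F : Type*) [Field F] {P : Type*} [PartialOrder P] (π : HassePath P) :
    (FreeAlgebra F (HasseEdge P))[X] :=
  (π.edges.map fun e => Polynomial.X - Polynomial.C (FreeAlgebra.ι F e)).prod

/-- The defining relations `e(π₁, i) = e(π₂, i)`, for all `i` and all paths `π₁`, `π₂` with the
same tail and the same head, where `e(π, i)` is the coefficient of `t ^ i` in `π.poly F`. -/
inductive Rel (F : Type*) [Field F] (P : Type*) [PartialOrder P] :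
    FreeAlgebra F (HasseEdge P) → FreeAlgebra F (HasseEdge P) → Prop
  | coeff (π₁ π₂ : HassePath P) (htail : π₁.tail = π₂.tail) (hhead : π₁.head = π₂.head) (i : ℕ) :
      Rel F P ((π₁.poly F).coeff i) ((π₂.poly F).coeff i)

/-- The splitting algebra `A(P)`: the quotient of the free algebra on the edges of the Hasse
diagram by the two-sided ideal generated by the differences `e(π₁, i) - e(π₂, i)`. -/
abbrev Alg (F : Type*) [Field F] (P : Type*) [PartialOrder P] : Type _ := RingQuot (Rel F P)

/-- The degree `n` component of the free algebra on the edges: the span of the words of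
length `n`. -/
def freeDegree (F : Type*) [Field F] (P : Type*) [PartialOrder P] (n : ℕ) :
    Submodule F (FreeAlgebra F (HasseEdge P)) :=
  Submodule.span F (Set.range (FreeAlgebra.ι F)) ^ n

/-- The degree `n` component of `A(P)`: the image of the degree `n` component of the free
algebra. -/
def degree (F : Type*) [Field F] (P : Type*) [PartialOrder P] (n : ℕ) : Submodule F (Alg F P) :=
  (freeDegree F P n).map (RingQuot.mkAlgHom F (Rel F P)).toLinearMap

/-- The graded components are finite-dimensional, so `Module.finrank` is their dimension. -/
theorem finite_degree (F : Type*) [Field F] (P : Type*) [PartialOrder P] [Finite P] (n : ℕ) :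
    Module.Finite F (degree F P n) := by
  have : Finite (HasseEdge P) := inferInstanceAs (Finite {e : P × P // e.2 ⋖ e.1})
  exact Module.Finite.iff_fg.2
    (((Submodule.fg_span (Set.finite_range _)).pow n).map _)

/-- The Hilbert series `∑ₙ dim A(P)ₙ zⁿ`, as a formal power series. -/
def hilbertSeries (F : Type*) [Field F] (P : Type*) [PartialOrder P] : ℚ⟦X⟧ :=
  PowerSeries.mk fun n => (Module.finrank F (degree F P n) : ℚ)

/-- The Möbius polynomial, seen as a formal power series with rational coefficients. -/
def mobiusSeries {P : Type*} [PartialOrder P] [Fintype P] [DecidableEq P]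
    [LocallyFiniteOrder P] (ρ : P → ℕ) : ℚ⟦X⟧ :=
  (((mobiusPolynomial ρ).map (Int.castRingHom ℚ) : ℚ[X]) : ℚ⟦X⟧)

end SplittingAlgebra

end

open Polynomial PowerSeries

noncomputable section

namespace SplittingAlgebra

/-! ### Normal words and their degrees -/

section

variable {P : Type*} [PartialOrder P] {ρ : P → ℕ}

/-! Let S be a finite ranked poset with least element o, and write ρ for its rank function. A path
from u down to o yields a monic polynomial p_u over A(S) of degree ρ(u), independent of the path,
and p_u is a left multiple of p_v for v ≤ u. The normal words in the coefficients (u, j) of the p_u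
form a basis of A(S): a letter (u, ρ(v)) is never followed by a letter of v < u.

To prove this, A(S) is made to act from the right on the formal span of the normal words. A
substitute for the left multiples of p_v is written down in polynomials over this span. Division
with remainder (`single_mem_reducible`, `eq_zero_of_linearCombination_mem_lower`) shows that each x
has a unique multiple x p_v with leading term x t^ρ(v). An edge e acts through x p_tail = t (x
p_head) - (x e) p_head (`rightMul_tail`). Iterating this along a path shows that the defining
relations hold (`freeAct_coeff_eq`). Evaluating words in A(S) respects the action, and acting on the
empty word inverts it, so dimensions count normal words (`finrank_degree`).

Let G count all normal words by degree and G_v those that a letter of v may follow. Splitting off a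
blocking letter gives G = ∑_{u ≥ v} z^(ρ(u)-ρ(v)) G_u for every v, so Möbius inversion gives M G = ∑
G_v. Splitting off the last letter gives G = 1 + ∑_u (z + ... + z^ρ(u)) G_u. Multiplying by 1 - z
and using the first identity at v = o yields G (1 - z M) = 1 - z. Finally M is multiplicative on
products, because μ is. -/

/-- The letter `(v, j)`, with `j < ρ v`, stands for the coefficient of `t ^ j` in the monic
polynomial of degree `ρ v` attached to the vertex `v`. -/
abbrev Letter (ρ : P → ℕ) : Type _ := Σ v : P, Fin (ρ v)

/-- The letter `(u, j)` must not be followed by a letter of a vertex `v < u` with `ρ v = j`. -/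
def Blocks (a : Letter ρ) (v : P) : Prop := v < a.1 ∧ (a.2 : ℕ) = ρ v

/-- Normal words, as lists with the last letter in front. -/
def Word (ρ : P → ℕ) : Type _ :=
  {l : List (Letter ρ) // l.IsChain fun b a => ¬ Blocks a b.1}

namespace Word

/-- The empty word. -/
def nil : Word ρ := ⟨[], .nil⟩

/-- The word `w` may be followed by the letters of the vertex `v`. -/
def Good (w : Word ρ) (v : P) : Prop := ∀ a ∈ w.1.head?, ¬ Blocks a v

/-- The word `w` followed by the letter `(v, j)`. -/
def snoc (w : Word ρ) (v : P) (h : w.Good v) (j : Fin (ρ v)) : Word ρ :=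
  ⟨⟨v, j⟩ :: w.1, List.isChain_cons.2 ⟨h, w.2⟩⟩

theorem good_nil (v : P) : (nil : Word ρ).Good v := by simp [Good, nil]

theorem good_snoc {w : Word ρ} {u : P} {h : w.Good u} {j : Fin (ρ u)} {v : P} :
    (w.snoc u h j).Good v ↔ ¬ (v < u ∧ (j : ℕ) = ρ v) := by
  simp [Good, snoc, Blocks]

theorem good_snoc_self {w : Word ρ} {v : P} {h : w.Good v} {j : Fin (ρ v)} :
    (w.snoc v h j).Good v := good_snoc.2 fun h => h.1.false

theorem induction {motive : Word ρ → Prop} (w : Word ρ) (nil : motive nil)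
    (snoc : ∀ w v h j, motive w → motive (snoc w v h j)) : motive w := by
  obtain ⟨l, hl⟩ := w
  induction l with
  | nil => exact nil
  | cons a l ih =>
    obtain ⟨h₁, h₂⟩ := List.isChain_cons.1 hl
    exact snoc ⟨l, h₂⟩ a.1 h₁ a.2 (ih h₂)

theorem snoc_inj {w w' : Word ρ} {v v' : P} {h : w.Good v} {h' : w'.Good v'} {j : Fin (ρ v)}
    {j' : Fin (ρ v')} (e : w.snoc v h j = w'.snoc v' h' j') :
    w = w' ∧ v = v' ∧ (j : ℕ) = j' := by
  have := congrArg Subtype.val e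
  simp only [snoc, List.cons.injEq, Sigma.mk.injEq] at this
  obtain ⟨⟨rfl, h₂⟩, h₃⟩ := this
  exact ⟨Subtype.ext h₃, rfl, by rw [eq_of_heq h₂]⟩

theorem snoc_ne {w : Word ρ} {v : P} {h : w.Good v} {j : Fin (ρ v)} : w.snoc v h j ≠ w := by
  intro e
  have := congrArg (fun x => x.1.length) e
  simp [snoc] at this

/-- The degree of a word: the letter `(v, j)` has degree `ρ v - j`. -/
def deg (w : Word ρ) : ℕ := (w.1.map fun a => ρ a.1 - a.2).sum

@[simp] theorem deg_nil : (nil : Word ρ).deg = 0 := rfl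

theorem deg_snoc (w : Word ρ) (v : P) (h : w.Good v) (j : Fin (ρ v)) :
    (w.snoc v h j).deg + j = w.deg + ρ v := by
  have := j.2
  simp only [deg, snoc, List.map_cons, List.sum_cons]
  omega

theorem exists_of_not_good {w : Word ρ} {v : P} (hw : ¬ w.Good v) :
    ∃ (w' : Word ρ) (u : P) (h : w'.Good u) (j : Fin (ρ u)),
      v < u ∧ (j : ℕ) = ρ v ∧ w = w'.snoc u h j := by
  induction w using Word.induction with
  | nil => exact absurd (good_nil v) hw
  | snoc w u h j _ =>
    rw [good_snoc, not_not] at hw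
    exact ⟨w, u, h, j, hw.1, hw.2, rfl⟩

end Word

/-! ### Multiples of a vertex polynomial and division with remainder -/

section Module

variable (F : Type*) [Field F]

/-- The monic polynomial `w t ^ ρ v + ∑ j, w (v, j) t ^ j` obtained by letting the polynomial of
`v` act on a word `w` that may be followed by the letters of `v`. -/
def monicPoly (w : Word ρ) (v : P) (h : w.Good v) : Word ρ →₀ F[X] :=
  Finsupp.single w (Polynomial.X ^ ρ v) +
    ∑ j : Fin (ρ v), Finsupp.single (w.snoc v h j) (Polynomial.X ^ (j : ℕ))

variable {F}

theorem monicPoly_self (w : Word ρ) (v : P) (h : w.Good v) :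
    monicPoly F w v h w = Polynomial.X ^ ρ v := by
  classical
  simp [monicPoly, Word.snoc_ne]

theorem monicPoly_snoc (w : Word ρ) (v : P) (h : w.Good v) (j : Fin (ρ v)) :
    monicPoly F w v h (w.snoc v h j) = Polynomial.X ^ (j : ℕ) := by
  classical
  rw [monicPoly, Finsupp.add_apply, Finsupp.finsetSum_apply, Finset.sum_eq_single j]
  · simp [Word.snoc_ne.symm]
  · intro k _ hk
    rw [Finsupp.single_apply, if_neg]
    exact fun e => hk (Fin.ext (Word.snoc_inj e).2.2)
  · simp

theorem monicPoly_ne_zero {w : Word ρ} {v : P} {h : w.Good v} {x : Word ρ}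
    (hx : monicPoly F w v h x ≠ 0) : x = w ∨ ∃ j, x = w.snoc v h j := by
  classical
  by_contra! H
  apply hx
  rw [monicPoly, Finsupp.add_apply, Finsupp.finsetSum_apply, Finsupp.single_eq_of_ne H.1, zero_add]
  exact Finset.sum_eq_zero fun j _ => Finsupp.single_eq_of_ne (H.2 j)

variable (F)

open Classical in
/-- The unique polynomial `monicPoly F w' u h`, `v ≤ u`, with a term `w t ^ ρ v`, where moreover
`u ≠ v` only if the last letter of `w` belongs to `u` and blocks `v`. -/
def generator (v : P) : Word ρ → (Word ρ →₀ F[X])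
  | ⟨[], h⟩ => monicPoly F ⟨[], h⟩ v (Word.good_nil v)
  | ⟨a :: l, h⟩ =>
    if hv : Blocks a v then
      monicPoly F ⟨l, (List.isChain_cons.1 h).2⟩ a.1 (List.isChain_cons.1 h).1
    else monicPoly F ⟨a :: l, h⟩ v (by simpa [Word.Good] using hv)

variable {F}

theorem generator_of_good {v : P} {w : Word ρ} (h : w.Good v) :
    generator F v w = monicPoly F w v h := by
  obtain ⟨_ | ⟨a, l⟩, hl⟩ := w
  · rfl
  · rw [generator, dif_neg (by simpa [Word.Good] using h)]

theorem generator_snoc {v u : P} {w : Word ρ} (h : w.Good u) (j : Fin (ρ u)) (hv : v < u)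
    (hj : (j : ℕ) = ρ v) : generator F v (w.snoc u h j) = monicPoly F w u h := by
  rw [Word.snoc, generator, dif_pos ⟨hv, hj⟩]
  rfl

variable (F) in
/-- The multiples of the polynomial attached to `v`. -/
def multiples (ρ : P → ℕ) (v : P) : Submodule F[X] (Word ρ →₀ F[X]) :=
  Submodule.span F[X] (Set.range (generator F v))

/-- The formal shadow of p_u being a left multiple of p_v. For v < u the polynomial is the generator
at the non-normal spot `w (u, ρ v)`, a legitimate letter since `ρ v < ρ u`. -/
theorem monicPoly_mem_multiples (hρ : StrictMono ρ) {w : Word ρ} {v u : P} (h : w.Good u)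
    (hv : v ≤ u) : monicPoly F w u h ∈ multiples F ρ v := by
  apply Submodule.subset_span
  rcases hv.eq_or_lt with rfl | hv
  · exact ⟨w, generator_of_good h⟩
  · exact ⟨w.snoc u h ⟨ρ v, hρ hv⟩, generator_snoc h _ hv rfl⟩

theorem exists_generator_eq (v : P) (w : Word ρ) :
    ∃ (w' : Word ρ) (u : P) (h : w'.Good u), v ≤ u ∧ generator F v w = monicPoly F w' u h := by
  by_cases hg : w.Good v
  · exact ⟨w, v, hg, le_rfl, generator_of_good hg⟩
  · obtain ⟨w', u, h, j, hv, hj, rfl⟩ := Word.exists_of_not_good hg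
    exact ⟨w', u, h, hv.le, generator_snoc h j hv hj⟩

theorem multiples_anti (hρ : StrictMono ρ) : Antitone (multiples F ρ) := by
  intro v u hv
  refine Submodule.span_le.2 ?_
  rintro _ ⟨w, rfl⟩
  obtain ⟨w', u', h, hu, e⟩ := exists_generator_eq (F := F) u w
  rw [e]
  exact monicPoly_mem_multiples hρ h (hv.trans hu)

variable (F) in
/-- The polynomials of degree less than `d` with coefficients in the span of the words. -/
def lower (ρ : P → ℕ) (d : ℕ) : Submodule F (Word ρ →₀ F[X]) where
  carrier := {f | ∀ w i, d ≤ i → (f w).coeff i = 0}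
  add_mem' hf hg w i hi := by simp [hf w i hi, hg w i hi]
  zero_mem' := by simp
  smul_mem' c f hf w i hi := by simp [hf w i hi]

variable (F) in
/-- The homogeneous polynomials of degree `m`, where `t` has degree one. -/
def homogeneous (ρ : P → ℕ) (m : ℕ) : Submodule F (Word ρ →₀ F[X]) where
  carrier := {f | ∀ w i, w.deg + i ≠ m → (f w).coeff i = 0}
  add_mem' hf hg w i hi := by simp [hf w i hi, hg w i hi]
  zero_mem' := by simp
  smul_mem' c f hf w i hi := by simp [hf w i hi]

theorem single_mem_homogeneous {w : Word ρ} {i m : ℕ} (h : w.deg + i = m) :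
    Finsupp.single w (Polynomial.X ^ i) ∈ homogeneous F ρ m := by
  classical
  intro x k hk
  rw [Finsupp.single_apply]
  split_ifs with hx
  · subst hx
    rw [Polynomial.coeff_X_pow, if_neg]
    omega
  · simp

theorem monicPoly_mem_homogeneous (w : Word ρ) (v : P) (h : w.Good v) :
    monicPoly F w v h ∈ homogeneous F ρ (w.deg + ρ v) :=
  add_mem (single_mem_homogeneous rfl) <| sum_mem fun j _ =>
    single_mem_homogeneous (w.deg_snoc v h j)

theorem X_pow_smul_mem_homogeneous {f : Word ρ →₀ F[X]} {m : ℕ} (hf : f ∈ homogeneous F ρ m)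
    (k : ℕ) : (Polynomial.X ^ k : F[X]) • f ∈ homogeneous F ρ (m + k) := by
  intro w i hi
  rw [Finsupp.smul_apply, smul_eq_mul, Polynomial.coeff_X_pow_mul']
  split_ifs with h
  · exact hf w _ (by omega)
  · rfl

theorem X_pow_smul_monicPoly (w : Word ρ) (v : P) (h : w.Good v) (k : ℕ) :
    (Polynomial.X ^ k : F[X]) • monicPoly F w v h =
      Finsupp.single w (Polynomial.X ^ (ρ v + k)) +
        ∑ j : Fin (ρ v), Finsupp.single (w.snoc v h j) (Polynomial.X ^ (j + k)) := by
  simp [monicPoly, Finset.smul_sum, pow_add, mul_comm]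

variable (F) in
/-- The sum of the homogeneous multiples of the polynomial attached to `v`, and the polynomials of
degree less than `ρ v`. -/
def reducible (ρ : P → ℕ) (v : P) (m : ℕ) : Submodule F (Word ρ →₀ F[X]) :=
  ((multiples F ρ v).restrictScalars F ⊓ homogeneous F ρ m) ⊔ lower F ρ (ρ v)

theorem X_pow_smul_monicPoly_mem_reducible (hρ : StrictMono ρ) {w : Word ρ} {v u : P}
    (h : w.Good u) (hv : v ≤ u) (k m : ℕ) (hm : w.deg + ρ u + k = m) :
    Finsupp.single w (Polynomial.X ^ (ρ u + k)) +
        ∑ j : Fin (ρ u), Finsupp.single (w.snoc u h j) (Polynomial.X ^ (j + k)) ∈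
      reducible F ρ v m := by
  subst hm
  rw [← X_pow_smul_monicPoly]
  exact Submodule.mem_sup_left ⟨Submodule.smul_mem _ _ (monicPoly_mem_multiples hρ h hv),
    X_pow_smul_mem_homogeneous (monicPoly_mem_homogeneous w u h) k⟩

theorem single_mem_reducible_of_lt {w : Word ρ} {v : P} {i m : ℕ} (hi : i < ρ v) :
    Finsupp.single w (Polynomial.X ^ i) ∈ reducible F ρ v m := by
  classical
  refine Submodule.mem_sup_right fun x k hk => ?_
  rw [Finsupp.single_apply]
  split_ifs
  · rw [Polynomial.coeff_X_pow, if_neg]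
    omega
  · simp

theorem single_mem_reducible_of_good (hρ : StrictMono ρ) {v : P} {m : ℕ} (i : ℕ) :
    ∀ w : Word ρ, w.Good v → w.deg + i = m →
      Finsupp.single w (Polynomial.X ^ i) ∈ reducible F ρ v m := by
  induction i using Nat.strong_induction_on with
  | _ i ih =>
    intro w h hm
    rcases lt_or_ge i (ρ v) with hi | hi
    · exact single_mem_reducible_of_lt hi
    · obtain ⟨k, rfl⟩ := Nat.exists_eq_add_of_le hi
      refine (Submodule.add_mem_iff_left _ ?_).1
        (X_pow_smul_monicPoly_mem_reducible hρ h le_rfl k m (by omega))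
      refine sum_mem fun j _ => ih _ (by omega) _ Word.good_snoc_self ?_
      have := w.deg_snoc v h j
      omega

/-- The existence half of division by p_v, by induction on the word and, for words good for `v`, on
the exponent. -/
theorem single_mem_reducible (hρ : StrictMono ρ) {v : P} (w : Word ρ) :
    ∀ i m : ℕ, w.deg + i = m → Finsupp.single w (Polynomial.X ^ i) ∈ reducible F ρ v m := by
  induction w using Word.induction with
  | nil => exact fun i m hm => single_mem_reducible_of_good hρ i _ (Word.good_nil v) hm
  | snoc w u h j ih =>
    intro i m hm
    by_cases hg : (w.snoc u h j).Good v
    · exact single_mem_reducible_of_good hρ i _ hg hm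
    rw [Word.good_snoc, not_not] at hg
    rcases lt_or_ge i (ρ v) with hi | hi
    · exact single_mem_reducible_of_lt hi
    obtain ⟨k, rfl⟩ := Nat.exists_eq_add_of_le hi
    have hd := w.deg_snoc u h j
    have key := X_pow_smul_monicPoly_mem_reducible (F := F) hρ h hg.1.le k m (by omega)
    -- The term of the blocking letter is the one to reduce. The leading term has a shorter word,
    -- and the remaining words end in `(u, j')` with `j' ≠ ρ v`, hence are good for `v`.
    rw [← Finset.add_sum_erase _ _ (Finset.mem_univ j), ← add_assoc, hg.2] at key
    refine (Submodule.add_mem_iff_right _ (ih _ m (by omega))).1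
      ((Submodule.add_mem_iff_left _ ?_).1 key)
    refine sum_mem fun j' hj' => single_mem_reducible_of_good hρ _ _ ?_ ?_
    · rw [Word.good_snoc]
      rintro ⟨-, h'⟩
      exact Finset.ne_of_mem_erase hj' (Fin.ext (h'.trans hg.2.symm))
    · have := w.deg_snoc u h j'
      omega

/-- The uniqueness half of division: the generators are triangular, in word length for the blocked
words and then in the degree of the coefficients. -/
theorem eq_zero_of_linearCombination_mem_lower {v : P} {c : Word ρ →₀ F[X]}
    (hc : Finsupp.linearCombination F[X] (generator F v) c ∈ lower F ρ (ρ v)) : c = 0 := by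
  classical
  have hsum (x : Word ρ) : Finsupp.linearCombination F[X] (generator F v) c x =
      ∑ w ∈ c.support, c w * generator F v w x := by
    simp [Finsupp.linearCombination_apply, Finsupp.sum, Finsupp.finsetSum_apply]
  have hgood : ∀ w ∈ c.support, w.Good v := by
    by_contra! H
    -- A longest blocked word occurs only in its own generator: generators of good words involve
    -- good words only, and another blocked word whose generator contains `w` would be longer.
    obtain ⟨w, hw, hmax⟩ := (c.support.filter fun w => ¬ w.Good v).exists_max_image
      (fun w => w.1.length) (by simpa [Finset.Nonempty] using H)
    rw [Finset.mem_filter] at hw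
    obtain ⟨w', u, h, j, hv, hj, rfl⟩ := Word.exists_of_not_good hw.2
    have h₁ := hsum (w'.snoc u h j)
    rw [Finset.sum_eq_single_of_mem _ hw.1, generator_snoc h j hv hj, monicPoly_snoc, hj] at h₁
    · apply Finsupp.mem_support_iff.1 hw.1
      ext i
      have := hc (w'.snoc u h j) (i + ρ v) (by omega)
      rwa [h₁, Polynomial.coeff_mul_X_pow] at this
    · intro y hy hne
      apply mul_eq_zero_of_right
      by_contra h0
      by_cases hyg : y.Good v
      · rw [generator_of_good hyg] at h0
        rcases monicPoly_ne_zero h0 with e | ⟨k, e⟩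
        · exact hne e.symm
        · exact hw.2 (e ▸ Word.good_snoc_self)
      · obtain ⟨y', x, hx, k, hv', hk, rfl⟩ := Word.exists_of_not_good hyg
        rw [generator_snoc hx k hv' hk] at h0
        rcases monicPoly_ne_zero h0 with e | ⟨k', e⟩
        · have := hmax _ (Finset.mem_filter.2 ⟨hy, hyg⟩)
          rw [e] at this
          simp [Word.snoc] at this
        · obtain ⟨rfl, rfl, e'⟩ := Word.snoc_inj e
          exact hne (congrArg _ (Fin.ext (hk.trans hj.symm)))
  by_contra hne
  -- With only good words left, the other contributions to `w` come from `w = y (v, j)` and are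
  -- shifted by `j < ρ v`, too little to reach the leading term of `c w * X ^ ρ v`.
  obtain ⟨w, hw, hmax⟩ := c.support.exists_max_image (fun w => (c w).natDegree)
    (Finsupp.support_nonempty_iff.2 hne)
  have h₁ := hc w ((c w).natDegree + ρ v) (by omega)
  rw [hsum, finsetSum_coeff, Finset.sum_eq_single_of_mem _ hw,
    generator_of_good (hgood w hw), monicPoly_self, Polynomial.coeff_mul_X_pow] at h₁
  · exact Finsupp.mem_support_iff.1 hw (leadingCoeff_eq_zero.1 h₁)
  · intro y hy hyw
    rw [generator_of_good (hgood y hy)]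
    by_cases h0 : monicPoly F y v (hgood y hy) w = 0
    · simp [h0]
    rcases monicPoly_ne_zero h0 with e | ⟨j, e⟩
    · exact absurd e.symm hyw
    · have h₂ := hmax y hy
      have h₃ : monicPoly F y v (hgood y hy) w = Polynomial.X ^ (j : ℕ) :=
        (congrArg _ e).trans (monicPoly_snoc y v (hgood y hy) j)
      rw [h₃]
      apply coeff_eq_zero_of_natDegree_lt
      refine natDegree_mul_le.trans_lt ?_
      rw [natDegree_X_pow]
      omega

theorem eq_zero_of_mem_multiples_of_mem_lower {v : P} {f : Word ρ →₀ F[X]}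
    (hf : f ∈ multiples F ρ v) (hf' : f ∈ lower F ρ (ρ v)) : f = 0 := by
  obtain ⟨c, rfl⟩ := (Finsupp.mem_span_range_iff_exists_finsupp).1 hf
  have : Finsupp.linearCombination F[X] (generator F v) c ∈ lower F ρ (ρ v) := hf'
  rw [eq_zero_of_linearCombination_mem_lower this]
  simp

end Module

end

section

variable {P : Type*} [PartialOrder P] {ρ : P → ℕ} {F : Type*} [Field F]

/-! ### Coefficients of polynomials over the span of words -/

section Coefficient

variable (F) in
/-- The coefficient of `t ^ i`. -/
def coeffMap (ρ : P → ℕ) (i : ℕ) : (Word ρ →₀ F[X]) →ₗ[F] (Word ρ →₀ F) :=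
  Finsupp.mapRange.linearMap (Polynomial.lcoeff F i)

@[simp] theorem coeffMap_apply (i : ℕ) (f : Word ρ →₀ F[X]) (w : Word ρ) :
    coeffMap F ρ i f w = (f w).coeff i := rfl

theorem mem_lower_iff {d : ℕ} {f : Word ρ →₀ F[X]} :
    f ∈ lower F ρ d ↔ ∀ i, d ≤ i → coeffMap F ρ i f = 0 :=
  ⟨fun h i hi => Finsupp.ext fun w => h w i hi, fun h w i hi => DFunLike.congr_fun (h i hi) w⟩

theorem coeffMap_X_pow_smul (k i : ℕ) (f : Word ρ →₀ F[X]) :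
    coeffMap F ρ i ((Polynomial.X ^ k : F[X]) • f) =
      if k ≤ i then coeffMap F ρ (i - k) f else 0 := by
  ext w
  rw [coeffMap_apply, Finsupp.smul_apply, smul_eq_mul, Polynomial.coeff_X_pow_mul']
  split_ifs <;> simp

theorem coeffMap_single_X_pow (w : Word ρ) (k i : ℕ) :
    coeffMap F ρ i (Finsupp.single w (Polynomial.X ^ k)) =
      if i = k then Finsupp.single w 1 else 0 := by
  rw [coeffMap, Finsupp.mapRange.linearMap_apply, Finsupp.mapRange_single, lcoeff_apply,
    Polynomial.coeff_X_pow]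
  split_ifs <;> simp

theorem coeffMap_monicPoly_self (w : Word ρ) (v : P) (h : w.Good v) :
    coeffMap F ρ (ρ v) (monicPoly F w v h) = Finsupp.single w 1 := by
  rw [monicPoly, map_add, map_sum, Finset.sum_eq_zero, add_zero, coeffMap_single_X_pow, if_pos rfl]
  intro j _
  rw [coeffMap_single_X_pow, if_neg j.2.ne']

theorem coeffMap_monicPoly_fin (w : Word ρ) (v : P) (h : w.Good v) (j : Fin (ρ v)) :
    coeffMap F ρ j (monicPoly F w v h) = Finsupp.single (w.snoc v h j) 1 := by
  rw [monicPoly, map_add, map_sum, coeffMap_single_X_pow, if_neg j.2.ne, zero_add,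
    Finset.sum_eq_single j, coeffMap_single_X_pow, if_pos rfl]
  · intro k _ hk
    rw [coeffMap_single_X_pow, if_neg fun e => hk (Fin.ext e.symm)]
  · simp

theorem coeffMap_monicPoly_of_lt (w : Word ρ) (v : P) (h : w.Good v) {i : ℕ} (hi : ρ v < i) :
    coeffMap F ρ i (monicPoly F w v h) = 0 := by
  rw [monicPoly, map_add, map_sum, coeffMap_single_X_pow, if_neg hi.ne', zero_add]
  refine Finset.sum_eq_zero fun j _ => ?_
  rw [coeffMap_single_X_pow, if_neg]
  omega

variable (F) in
/-- The span of the words of degree `n`. -/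
def wordDegree (ρ : P → ℕ) (n : ℕ) : Submodule F (Word ρ →₀ F) :=
  Finsupp.supported F F {w | w.deg = n}

theorem coeffMap_mem_wordDegree {f : Word ρ →₀ F[X]} {m n i : ℕ} (hf : f ∈ homogeneous F ρ m)
    (h : n + i = m) : coeffMap F ρ i f ∈ wordDegree F ρ n := by
  rw [wordDegree, Finsupp.mem_supported']
  exact fun w hw => hf w i fun e => hw (Nat.add_right_cancel (e.trans h.symm))

theorem exists_mem_multiples (hρ : StrictMono ρ) (v : P) (w : Word ρ) :
    ∃ f ∈ multiples F ρ v, f ∈ homogeneous F ρ (w.deg + ρ v) ∧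
      f - Finsupp.single w (Polynomial.X ^ ρ v) ∈ lower F ρ (ρ v) := by
  obtain ⟨f, ⟨hf, hf'⟩, g, hg, e⟩ :=
    Submodule.mem_sup.1 (single_mem_reducible (F := F) (v := v) hρ w (ρ v) _ rfl)
  refine ⟨f, hf, hf', ?_⟩
  rw [← e, sub_add_cancel_left]
  exact neg_mem hg

end Coefficient

/-! ### The right action of the edges -/

section Action

/-- The right action of the monic polynomial attached to `v`: the image of `x` is the multiple of
this polynomial of the form `x t ^ ρ v +` lower terms. -/
def rightMul (hρ : StrictMono ρ) (v : P) : (Word ρ →₀ F) →ₗ[F] (Word ρ →₀ F[X]) :=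
  Finsupp.linearCombination F fun w => (exists_mem_multiples hρ v w).choose

theorem rightMul_single (hρ : StrictMono ρ) (v : P) (w : Word ρ) :
    rightMul hρ v (Finsupp.single w (1 : F)) = (exists_mem_multiples hρ v w).choose := by
  simp [rightMul]

theorem rightMul_mem (hρ : StrictMono ρ) (v : P) (x : Word ρ →₀ F) :
    rightMul hρ v x ∈ multiples F ρ v := by
  induction x using Finsupp.induction_linear with
  | zero => simp
  | add x y hx hy => simpa using add_mem hx hy
  | single w c =>
    rw [← Finsupp.smul_single_one, map_smul, rightMul_single]
    exact ((multiples F ρ v).restrictScalars F).smul_mem c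
      (exists_mem_multiples hρ v w).choose_spec.1

theorem coeffMap_rightMul (hρ : StrictMono ρ) (v : P) (x : Word ρ →₀ F) {i : ℕ} (hi : ρ v ≤ i) :
    coeffMap F ρ i (rightMul hρ v x) = if i = ρ v then x else 0 := by
  induction x using Finsupp.induction_linear with
  | zero => simp
  | add x y hx hy =>
    rw [map_add, map_add, hx, hy]
    split_ifs <;> simp
  | single w c =>
    have := mem_lower_iff.1 (exists_mem_multiples (F := F) hρ v w).choose_spec.2.2 i hi
    rw [map_sub, sub_eq_zero, coeffMap_single_X_pow] at this
    rw [← Finsupp.smul_single_one, map_smul, map_smul, rightMul_single, this]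
    split_ifs <;> simp

theorem coeffMap_rightMul_self (hρ : StrictMono ρ) (v : P) (x : Word ρ →₀ F) :
    coeffMap F ρ (ρ v) (rightMul hρ v x) = x := by
  rw [coeffMap_rightMul hρ v x le_rfl, if_pos rfl]

theorem coeffMap_rightMul_of_lt (hρ : StrictMono ρ) (v : P) (x : Word ρ →₀ F) {i : ℕ}
    (hi : ρ v < i) : coeffMap F ρ i (rightMul hρ v x) = 0 := by
  rw [coeffMap_rightMul hρ v x hi.le, if_neg hi.ne']

/-- By uniqueness of division, the arbitrary choices in `rightMul` do not matter: a multiple of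
degree at most `ρ v` is determined by its top coefficient. -/
theorem rightMul_coeffMap (hρ : StrictMono ρ) {v : P} {f : Word ρ →₀ F[X]}
    (hf : f ∈ multiples F ρ v) (hf' : ∀ i, ρ v < i → coeffMap F ρ i f = 0) :
    rightMul hρ v (coeffMap F ρ (ρ v) f) = f := by
  rw [← sub_eq_zero]
  refine eq_zero_of_mem_multiples_of_mem_lower (sub_mem (rightMul_mem hρ v _) hf)
    (mem_lower_iff.2 fun i hi => ?_)
  rcases hi.eq_or_lt with rfl | hi
  · rw [map_sub, coeffMap_rightMul_self, sub_self]
  · rw [map_sub, coeffMap_rightMul_of_lt hρ v _ hi, hf' i hi, sub_self]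

theorem rightMul_single_of_good (hρ : StrictMono ρ) {v : P} {w : Word ρ} (h : w.Good v) :
    rightMul hρ v (Finsupp.single w (1 : F)) = monicPoly F w v h := by
  rw [← coeffMap_monicPoly_self w v h]
  exact rightMul_coeffMap hρ (monicPoly_mem_multiples hρ h le_rfl)
    fun i hi => coeffMap_monicPoly_of_lt w v h hi

theorem rightMul_mem_homogeneous (hρ : StrictMono ρ) (v : P) {n : ℕ} {x : Word ρ →₀ F}
    (hx : x ∈ wordDegree F ρ n) : rightMul hρ v x ∈ homogeneous F ρ (n + ρ v) := by
  rw [rightMul, Finsupp.linearCombination_apply]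
  refine Submodule.sum_mem _ fun w hw => Submodule.smul_mem _ _ ?_
  have : w.deg = n := (Finsupp.mem_supported F x).1 hx hw
  exact this ▸ (exists_mem_multiples hρ v w).choose_spec.2.1

theorem sum_X_pow_smul_rightMul_eq_zero (hρ : StrictMono ρ) (v : P) (y : ℕ → Word ρ →₀ F) (M : ℕ)
    (h : ∑ i ∈ Finset.range M, (Polynomial.X ^ i : F[X]) • rightMul hρ v (y i) = 0) :
    ∀ i < M, y i = 0 := by
  induction M with
  | zero => simp
  | succ M ih =>
    have hM : y M = 0 := by
      have := congrArg (coeffMap F ρ (M + ρ v)) h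
      rwa [map_sum, map_zero, Finset.sum_range_succ, coeffMap_X_pow_smul, if_pos (by omega),
        Nat.add_sub_cancel_left, coeffMap_rightMul_self, Finset.sum_eq_zero, zero_add] at this
      intro i hi
      rw [Finset.mem_range] at hi
      rw [coeffMap_X_pow_smul, if_pos (by omega), coeffMap_rightMul_of_lt hρ v _ (by omega)]
    rw [Finset.sum_range_succ, hM, map_zero, smul_zero, add_zero] at h
    intro i hi
    rcases Nat.lt_succ_iff_lt_or_eq.1 hi with hi | rfl
    exacts [ih h i hi, hM]

/-- The right action of an edge on the span of the normal words. -/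
def edgeMul (hρ : StrictMono ρ) (e : HasseEdge P) : Module.End F (Word ρ →₀ F) :=
  coeffMap F ρ (ρ e.head) ∘ₗ
    (Algebra.lsmul F F (Word ρ →₀ F[X]) (Polynomial.X : F[X]) ∘ₗ rightMul hρ e.head - rightMul hρ e.tail)

theorem edgeMul_apply (hρ : StrictMono ρ) (e : HasseEdge P) (x : Word ρ →₀ F) :
    edgeMul hρ e x = coeffMap F ρ (ρ e.head)
      ((Polynomial.X : F[X]) • rightMul hρ e.head x - rightMul hρ e.tail x) := rfl

/-- Both `t (x p_head)` and `x p_tail` are multiples of p_head with leading term `x t ^ ρ e.tail`.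
Their difference has degree at most `ρ e.head`, so it is the product of its top coefficient, by
definition `edgeMul hρ e x`, with p_head. -/
theorem rightMul_tail (hρ : StrictMono ρ) (hr : IsRankFunction ρ) (e : HasseEdge P)
    (x : Word ρ →₀ F) : rightMul hρ e.tail x =
      (Polynomial.X : F[X]) • rightMul hρ e.head x - rightMul hρ e.head (edgeMul hρ e x) := by
  have hc : e.head ⋖ e.tail := e.2
  have he := hr.covBy _ _ hc
  rw [edgeMul_apply, rightMul_coeffMap, sub_sub_cancel]
  · exact sub_mem (Submodule.smul_mem _ _ (rightMul_mem hρ _ x))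
      (multiples_anti hρ hc.le (rightMul_mem hρ _ x))
  · intro i hi
    have hX := coeffMap_X_pow_smul 1 i (rightMul hρ e.head x)
    rw [pow_one, if_pos (by omega)] at hX
    rw [map_sub, hX, coeffMap_rightMul hρ _ _ (by omega), coeffMap_rightMul hρ _ _ (by omega)]
    by_cases h : i = ρ e.tail
    · rw [if_pos (by omega), if_pos h, sub_self]
    · rw [if_neg (by omega), if_neg h, sub_self]

theorem edgeMul_mem_wordDegree (hρ : StrictMono ρ) (hr : IsRankFunction ρ) (e : HasseEdge P) {n : ℕ}
    {x : Word ρ →₀ F} (hx : x ∈ wordDegree F ρ n) : edgeMul hρ e x ∈ wordDegree F ρ (n + 1) := by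
  have he := hr.covBy e.head e.tail e.2
  rw [edgeMul_apply]
  have h₁ := X_pow_smul_mem_homogeneous (rightMul_mem_homogeneous hρ e.head hx) 1
  have h₂ := rightMul_mem_homogeneous hρ e.tail hx
  rw [pow_one] at h₁
  rw [he] at h₂
  exact coeffMap_mem_wordDegree (sub_mem h₁ h₂) (by omega)

/-- The right action of the free algebra on the span of the normal words. -/
def freeAct (hρ : StrictMono ρ) :
    FreeAlgebra F (HasseEdge P) →ₐ[F] (Module.End F (Word ρ →₀ F))ᵐᵒᵖ :=
  FreeAlgebra.lift F fun e => MulOpposite.op (edgeMul hρ e)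

theorem freeAct_ι (hρ : StrictMono ρ) (e : HasseEdge P) :
    freeAct hρ (FreeAlgebra.ι F e) = MulOpposite.op (edgeMul hρ e) := by
  simp [freeAct]

end Action

/-! ### Paths and the defining relations -/

section Path

/-- The list of edges `es` is a path, possibly empty, from `u` down to `v`. -/
def IsPath : List (HasseEdge P) → P → P → Prop
  | [], u, v => u = v
  | e :: es, u, v => e.tail = u ∧ IsPath es e.head v

theorem HassePath.isPath (π : HassePath P) : IsPath π.edges π.tail π.head := by
  obtain ⟨es, hne, hc⟩ := π
  simp only [HassePath.tail, HassePath.head]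
  induction es with
  | nil => exact absurd rfl hne
  | cons e es ih =>
    cases es with
    | nil => exact ⟨rfl, rfl⟩
    | cons f es =>
      obtain ⟨h₁, h₂⟩ := List.isChain_cons_cons.1 hc
      refine ⟨rfl, ?_⟩
      rw [h₁]
      exact ih (by simp) h₂

theorem IsPath.exists_hassePath {es : List (HasseEdge P)} {u v : P} (h : IsPath es u v)
    (hne : es ≠ []) : ∃ π : HassePath P, π.edges = es ∧ π.tail = u ∧ π.head = v := by
  suffices H : es.IsChain (fun e f => e.head = f.tail) ∧ (es.head hne).tail = u ∧
      (es.getLast hne).head = v from ⟨⟨es, hne, H.1⟩, rfl, H.2⟩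
  induction es generalizing u with
  | nil => exact absurd rfl hne
  | cons e es ih =>
    cases es with
    | nil => exact ⟨.singleton _, h.1, h.2⟩
    | cons f es =>
      obtain ⟨h₁, h₂, h₃⟩ := ih h.2 (by simp)
      exact ⟨List.isChain_cons_cons.2 ⟨h₂.symm, h₁⟩, h.1, h₃⟩

theorem exists_isPath [LocallyFiniteOrder P] {v u : P} (h : v ≤ u) : ∃ es, IsPath es u v := by
  induction le_iff_reflTransGen_covBy.1 h with
  | refl => exact ⟨[], rfl⟩
  | @tail b c hb hc ih =>
    obtain ⟨es, hes⟩ := ih (le_iff_reflTransGen_covBy.2 hb)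
    exact ⟨⟨(c, b), hc⟩ :: es, rfl, hes⟩

theorem IsPath.rank_eq (hr : IsRankFunction ρ) {es : List (HasseEdge P)} {u v : P}
    (h : IsPath es u v) : ρ u = ρ v + es.length := by
  induction es generalizing u with
  | nil => exact congrArg ρ h
  | cons e es ih =>
    obtain ⟨rfl, h⟩ := h
    rw [hr.covBy e.head e.tail e.2, ih h, List.length_cons, add_assoc]

variable (F) in
/-- The polynomial `(t - e₁)(t - e₂)⋯(t - eₙ)` of a list of edges. -/
def edgePoly (es : List (HasseEdge P)) : (FreeAlgebra F (HasseEdge P))[X] :=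
  (es.map fun e => Polynomial.X - Polynomial.C (FreeAlgebra.ι F e)).prod

theorem edgePoly_cons (e : HasseEdge P) (es : List (HasseEdge P)) : edgePoly F (e :: es) =
    (Polynomial.X - Polynomial.C (FreeAlgebra.ι F e)) * edgePoly F es := by
  simp [edgePoly]

theorem edgePoly_monic (es : List (HasseEdge P)) : (edgePoly F es).Monic := by
  induction es with
  | nil => simp [edgePoly]
  | cons e es ih =>
    rw [edgePoly_cons]
    exact (monic_X_sub_C _).mul ih

theorem edgePoly_natDegree (es : List (HasseEdge P)) : (edgePoly F es).natDegree = es.length := by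
  induction es with
  | nil => simp [edgePoly]
  | cons e es ih =>
    rw [edgePoly_cons, (monic_X_sub_C _).natDegree_mul (edgePoly_monic es), natDegree_X_sub_C, ih,
      List.length_cons, add_comm]

/-- This iterates `rightMul_tail` and says x p_u = ∑ t^i (x e(π, i)) p_v. The coefficients of such
an expansion are unique, which forces the relations of the splitting algebra. -/
theorem rightMul_of_isPath (hρ : StrictMono ρ) (hr : IsRankFunction ρ) {es : List (HasseEdge P)}
    {u v : P} (h : IsPath es u v) (x : Word ρ →₀ F) {M : ℕ} (hM : es.length < M) :
    rightMul hρ u x = ∑ i ∈ Finset.range M, (Polynomial.X ^ i : F[X]) •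
      rightMul hρ v ((freeAct hρ ((edgePoly F es).coeff i)).unop x) := by
  induction es generalizing u x M with
  | nil =>
    obtain rfl : u = v := h
    rw [Finset.sum_eq_single_of_mem 0 (by simpa using hM)]
    · simp [edgePoly]
    · intro i _ hi
      simp [edgePoly, Polynomial.coeff_one, hi]
  | cons e es ih =>
    obtain ⟨rfl, h⟩ := h
    obtain ⟨M, rfl⟩ : ∃ M', M = M' + 1 := ⟨M - 1, by omega⟩
    rw [List.length_cons, Nat.add_lt_add_iff_right] at hM
    rw [rightMul_tail hρ hr, ih h x hM, ih h (edgeMul hρ e x) (hM.trans M.lt_succ_self),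
      Finset.sum_range_succ', Finset.sum_range_succ' _ M, Finset.smul_sum, ← sub_sub,
      ← Finset.sum_sub_distrib, sub_eq_add_neg]
    congr 1
    · refine Finset.sum_congr rfl fun i _ => ?_
      rw [edgePoly_cons, sub_mul, Polynomial.coeff_sub, Polynomial.coeff_X_mul, Polynomial.coeff_C_mul, map_sub,
        map_mul, freeAct_ι, smul_smul, ← pow_succ', MulOpposite.unop_sub, MulOpposite.unop_mul,
        LinearMap.sub_apply, map_sub, smul_sub]
      rfl
    · rw [edgePoly_cons, sub_mul, Polynomial.coeff_sub, mul_coeff_zero, coeff_X_zero, zero_mul,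
        zero_sub, Polynomial.coeff_C_mul, map_neg, map_mul, freeAct_ι]
      simp

theorem freeAct_coeff_eq (hρ : StrictMono ρ) (hr : IsRankFunction ρ) {es es' : List (HasseEdge P)}
    {u v : P} (h : IsPath es u v) (h' : IsPath es' u v) (i : ℕ) :
    freeAct (F := F) hρ ((edgePoly F es).coeff i) = freeAct hρ ((edgePoly F es').coeff i) := by
  apply MulOpposite.unop_injective
  refine LinearMap.ext fun x => ?_
  have h₁ := rightMul_of_isPath hρ hr h x (M := max i (max es.length es'.length) + 1) (by omega)
  rw [rightMul_of_isPath hρ hr h' x (M := max i (max es.length es'.length) + 1) (by omega),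
    ← sub_eq_zero, ← Finset.sum_sub_distrib] at h₁
  simp only [← smul_sub, ← map_sub] at h₁
  exact (sub_eq_zero.1 (sum_X_pow_smul_rightMul_eq_zero hρ v _ _ h₁ i (by omega))).symm

variable (F) in
/-- The right action of the splitting algebra on the span of the normal words. -/
def act (hρ : StrictMono ρ) (hr : IsRankFunction ρ) :
    Alg F P →ₐ[F] (Module.End F (Word ρ →₀ F))ᵐᵒᵖ :=
  RingQuot.liftAlgHom F ⟨freeAct hρ, fun {_ _} h => by
    obtain ⟨π₁, π₂, ht, hh, i⟩ := h
    have h₁ := π₁.isPath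
    rw [ht, hh] at h₁
    exact freeAct_coeff_eq hρ hr h₁ π₂.isPath i⟩

theorem act_mk (hρ : StrictMono ρ) (hr : IsRankFunction ρ) (a : FreeAlgebra F (HasseEdge P)) :
    act F hρ hr (RingQuot.mkAlgHom F (Rel F P) a) = freeAct hρ a :=
  RingQuot.liftAlgHom_mkAlgHom_apply ..

/-- Needed for monic polynomials to keep their degree over the quotient. -/
theorem nontrivial_alg (hρ : StrictMono ρ) (hr : IsRankFunction ρ) : Nontrivial (Alg F P) := by
  have : Nonempty (Word ρ) := ⟨Word.nil⟩
  exact (act F hρ hr).toRingHom.domain_nontrivial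

/-- At a minimal vertex the rank is 0, so x p_v is the constant x and the expansion along the path
can be read off coefficientwise. -/
theorem act_coeff_edgePoly (hρ : StrictMono ρ) (hr : IsRankFunction ρ) {es : List (HasseEdge P)}
    {u v : P} (h : IsPath es u v) (hv : IsMin v) (x : Word ρ →₀ F) (i : ℕ) :
    (act F hρ hr (RingQuot.mkAlgHom F (Rel F P) ((edgePoly F es).coeff i))).unop x =
      coeffMap F ρ i (rightMul hρ u x) := by
  rw [act_mk, rightMul_of_isPath hρ hr h x (M := max i es.length + 1) (by omega), map_sum,
    Finset.sum_eq_single_of_mem i (by simp)]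
  · have hv' := (hr.eq_zero_iff v).2 hv
    rw [coeffMap_X_pow_smul, if_pos le_rfl, Nat.sub_self, ← hv', coeffMap_rightMul_self]
  · intro k _ hk
    rw [coeffMap_X_pow_smul]
    split_ifs with hki
    · have hv' := (hr.eq_zero_iff v).2 hv
      exact coeffMap_rightMul_of_lt hρ v _ (by omega)
    · rfl

end Path

end

section

variable {P : Type*} [PartialOrder P] {ρ : P → ℕ} {F : Type*} [Field F]

/-! ### Vertex polynomials over the splitting algebra -/

section Vertex

theorem rank_least {o : P} (hr : IsRankFunction ρ) (ho : ∀ v : P, o ≤ v) : ρ o = 0 :=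
  (hr.eq_zero_iff o).2 fun v _ => ho v

variable [LocallyFiniteOrder P] {o : P}

/-- A path from `v` to the least element `o`. -/
def pathToLeast (ho : ∀ v : P, o ≤ v) (v : P) : List (HasseEdge P) := (exists_isPath (ho v)).choose

theorem isPath_pathToLeast (ho : ∀ v : P, o ≤ v) (v : P) : IsPath (pathToLeast ho v) v o :=
  (exists_isPath (ho v)).choose_spec

variable (F) in
/-- The monic polynomial over the splitting algebra attached to a vertex. -/
def vertexPoly (ho : ∀ v : P, o ≤ v) (v : P) : (Alg F P)[X] :=
  (edgePoly F (pathToLeast ho v)).map (RingQuot.mkAlgHom F (Rel F P)).toRingHom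

theorem vertexPoly_coeff (ho : ∀ v : P, o ≤ v) (v : P) (i : ℕ) : (vertexPoly F ho v).coeff i =
    RingQuot.mkAlgHom F (Rel F P) ((edgePoly F (pathToLeast ho v)).coeff i) := by
  rw [vertexPoly, Polynomial.coeff_map]
  rfl

theorem vertexPoly_monic (ho : ∀ v : P, o ≤ v) (v : P) : (vertexPoly F ho v).Monic :=
  (edgePoly_monic _).map _

theorem length_pathToLeast (hr : IsRankFunction ρ) (ho : ∀ v : P, o ≤ v) (v : P) :
    (pathToLeast ho v).length = ρ v := by
  have := (isPath_pathToLeast ho v).rank_eq hr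
  rw [rank_least hr ho] at this
  omega

theorem vertexPoly_natDegree (hρ : StrictMono ρ) (hr : IsRankFunction ρ) (ho : ∀ v : P, o ≤ v)
    (v : P) : (vertexPoly F ho v).natDegree = ρ v := by
  have := nontrivial_alg (F := F) hρ hr
  rw [vertexPoly, (edgePoly_monic _).natDegree_map, edgePoly_natDegree, length_pathToLeast hr]

theorem vertexPoly_tail (ho : ∀ v : P, o ≤ v) (e : HasseEdge P) : vertexPoly F ho e.tail =
    (Polynomial.X + Polynomial.C (RingQuot.mkAlgHom F (Rel F P) (-FreeAlgebra.ι F e))) *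
      vertexPoly F ho e.head := by
  have h₁ := isPath_pathToLeast ho e.tail
  have h₂ : IsPath (e :: pathToLeast ho e.head) e.tail o := ⟨rfl, isPath_pathToLeast ho e.head⟩
  have hc : e.head ⋖ e.tail := e.2
  -- The relations concern nonempty paths only; the chosen path is nonempty since `e.tail` lies
  -- strictly above `e.head`, so is not `o`.
  obtain ⟨π₁, e₁, ht₁, hh₁⟩ := h₁.exists_hassePath fun h => by
    rw [h] at h₁
    have h' : e.tail = o := h₁
    exact absurd (h' ▸ hc.lt) (ho _).not_gt
  obtain ⟨π₂, e₂, ht₂, hh₂⟩ := h₂.exists_hassePath (by simp)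
  have key : vertexPoly F ho e.tail = (edgePoly F (e :: pathToLeast ho e.head)).map
      (RingQuot.mkAlgHom F (Rel F P)).toRingHom := by
    ext i
    rw [vertexPoly_coeff, Polynomial.coeff_map, ← e₁, ← e₂]
    exact RingQuot.mkAlgHom_rel F (Rel.coeff π₁ π₂ (ht₁.trans ht₂.symm) (hh₁.trans hh₂.symm) i)
  rw [key, edgePoly_cons, sub_eq_add_neg, ← Polynomial.C_neg, Polynomial.map_mul,
    Polynomial.map_add, Polynomial.map_X, Polynomial.map_C]
  rfl

theorem vertexPoly_eq_mul (ho : ∀ v : P, o ≤ v) {v u : P} (h : v ≤ u) :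
    ∃ q, vertexPoly F ho u = q * vertexPoly F ho v := by
  induction le_iff_reflTransGen_covBy.1 h with
  | refl => exact ⟨1, (one_mul _).symm⟩
  | @tail b c hb hc ih =>
    obtain ⟨q, hq⟩ := ih (le_iff_reflTransGen_covBy.2 hb)
    have := vertexPoly_tail (F := F) ho ⟨(c, b), hc⟩
    exact ⟨_, this.trans ((congrArg _ hq).trans (mul_assoc _ _ _).symm)⟩

end Vertex

/-! ### Evaluation of normal words -/

section Evaluation

variable [LocallyFiniteOrder P] {o : P}

variable (F) in
/-- The element of the splitting algebra that a normal word stands for. -/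
def evalWord (ho : ∀ v : P, o ≤ v) (w : Word ρ) : Alg F P :=
  (w.1.map fun a => (vertexPoly F ho a.1).coeff a.2).reverse.prod

theorem evalWord_nil (ho : ∀ v : P, o ≤ v) : evalWord F ho (Word.nil : Word ρ) = 1 := by
  simp [evalWord, Word.nil]

theorem evalWord_snoc (ho : ∀ v : P, o ≤ v) (w : Word ρ) (v : P) (h : w.Good v)
    (j : Fin (ρ v)) : evalWord F ho (w.snoc v h j) =
      evalWord F ho w * (vertexPoly F ho v).coeff j := by
  simp [evalWord, Word.snoc]

variable (F) in
/-- The linear map from the span of the normal words to the splitting algebra. -/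
def evalMap (ρ : P → ℕ) (ho : ∀ v : P, o ≤ v) : (Word ρ →₀ F) →ₗ[F] Alg F P :=
  Finsupp.linearCombination F (evalWord F ho)

theorem evalMap_single (ho : ∀ v : P, o ≤ v) (w : Word ρ) :
    evalMap F ρ ho (Finsupp.single w 1) = evalWord F ho w := by
  simp [evalMap]

theorem evalMap_coeffMap_monicPoly (hρ : StrictMono ρ) (hr : IsRankFunction ρ) (ho : ∀ v : P, o ≤ v)
    (w : Word ρ) (v : P) (h : w.Good v) (i : ℕ) :
    evalMap F ρ ho (coeffMap F ρ i (monicPoly F w v h)) =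
      evalWord F ho w * (vertexPoly F ho v).coeff i := by
  have hd := vertexPoly_natDegree (F := F) hρ hr ho v
  rcases lt_trichotomy i (ρ v) with hi | rfl | hi
  · have := coeffMap_monicPoly_fin (F := F) w v h ⟨i, hi⟩
    rw [this, evalMap_single, evalWord_snoc]
  · rw [coeffMap_monicPoly_self, evalMap_single, ← hd, (vertexPoly_monic ho v).coeff_natDegree, mul_one]
  · rw [coeffMap_monicPoly_of_lt w v h hi, map_zero, coeff_eq_zero_of_natDegree_lt (by omega),
      mul_zero]

/-- Evaluation turns formal multiples into genuine left multiples of p_v: a generator is some w' p_u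
with v ≤ u, and p_v divides p_u on the right. -/
theorem exists_evalMap_coeffMap_eq (hρ : StrictMono ρ) (hr : IsRankFunction ρ) (ho : ∀ v : P, o ≤ v)
    {v : P} {f : Word ρ →₀ F[X]} (hf : f ∈ multiples F ρ v) :
    ∃ a : (Alg F P)[X], ∀ i, evalMap F ρ ho (coeffMap F ρ i f) = (a * vertexPoly F ho v).coeff i := by
  induction hf using Submodule.span_induction with
  | mem f hf =>
    obtain ⟨w, rfl⟩ := hf
    obtain ⟨w', u, h, hv, e⟩ := exists_generator_eq (F := F) v w
    obtain ⟨q, hq⟩ := vertexPoly_eq_mul (F := F) ho hv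
    refine ⟨Polynomial.C (evalWord F ho w') * q, fun i => ?_⟩
    rw [e, evalMap_coeffMap_monicPoly hρ hr, mul_assoc, ← hq, Polynomial.coeff_C_mul]
  | zero => exact ⟨0, by simp⟩
  | add f g _ _ hf hg =>
    obtain ⟨a, ha⟩ := hf
    obtain ⟨b, hb⟩ := hg
    exact ⟨a + b, fun i => by simp [ha, hb, add_mul]⟩
  | smul p f _ hf =>
    obtain ⟨a, ha⟩ := hf
    induction p using Polynomial.induction_on' with
    | add p q hp hq =>
      obtain ⟨b, hb⟩ := hp
      obtain ⟨c, hc⟩ := hq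
      exact ⟨b + c, fun i => by rw [add_smul, map_add, map_add, hb, hc, add_mul,
        Polynomial.coeff_add]⟩
    | monomial n c =>
      refine ⟨c • (Polynomial.X ^ n * a), fun i => ?_⟩
      rw [← C_mul_X_pow_eq_monomial, ← Polynomial.smul_eq_C_mul, smul_assoc, map_smul, map_smul,
        coeffMap_X_pow_smul, smul_mul_assoc, Polynomial.coeff_smul, mul_assoc,
        Polynomial.coeff_X_pow_mul']
      split_ifs
      · rw [ha]
      · rw [map_zero]

theorem evalMap_coeffMap_rightMul (hρ : StrictMono ρ) (hr : IsRankFunction ρ) (ho : ∀ v : P, o ≤ v)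
    (v : P) (x : Word ρ →₀ F) (i : ℕ) : evalMap F ρ ho (coeffMap F ρ i (rightMul hρ v x)) =
      evalMap F ρ ho x * (vertexPoly F ho v).coeff i := by
  obtain ⟨a, ha⟩ := exists_evalMap_coeffMap_eq hρ hr ho (rightMul_mem hρ v x)
  have hm := vertexPoly_monic (F := F) ho v
  have hd := vertexPoly_natDegree (F := F) hρ hr ho v
  -- The cofactor is constant, since p_v is monic of degree `ρ v` and the product has degree at most
  -- `ρ v`.
  obtain ⟨a₀, rfl⟩ : ∃ a₀, a = Polynomial.C a₀ := by
    by_cases h0 : a = 0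
    · exact ⟨0, by simp [h0]⟩
    refine ⟨_, eq_C_of_natDegree_eq_zero ?_⟩
    have h₁ : (a * vertexPoly F ho v).natDegree ≤ ρ v := by
      refine natDegree_le_iff_coeff_eq_zero.2 fun i hi => ?_
      rw [← ha, coeffMap_rightMul_of_lt hρ v x hi, map_zero]
    rw [natDegree_mul' (by rwa [hm.leadingCoeff, mul_one, Ne, leadingCoeff_eq_zero]), hd] at h₁
    omega
  have h := ha (ρ v)
  rw [coeffMap_rightMul_self, Polynomial.coeff_C_mul, ← hd, hm.coeff_natDegree, mul_one] at h
  rw [ha, Polynomial.coeff_C_mul, h]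

/-- Over the algebra, t p_head - p_tail = e p_head, whose coefficient at `ρ e.head` is `e`. -/
theorem evalMap_edgeMul (hρ : StrictMono ρ) (hr : IsRankFunction ρ) (ho : ∀ v : P, o ≤ v)
    (e : HasseEdge P) (x : Word ρ →₀ F) : evalMap F ρ ho (edgeMul hρ e x) =
      evalMap F ρ ho x * RingQuot.mkAlgHom F (Rel F P) (FreeAlgebra.ι F e) := by
  have hd := vertexPoly_natDegree (F := F) hρ hr ho e.head
  have h₁ : (vertexPoly F ho e.head).coeff (ρ e.head) = 1 := by
    rw [← hd, (vertexPoly_monic ho e.head).coeff_natDegree]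
  have hX := coeffMap_X_pow_smul 1 (ρ e.head) (rightMul (F := F) hρ e.head x)
  have hX' := Polynomial.coeff_X_pow_mul' (vertexPoly F ho e.head) 1 (ρ e.head)
  rw [pow_one] at hX hX'
  rw [edgeMul_apply, map_sub, map_sub, hX, evalMap_coeffMap_rightMul hρ hr, vertexPoly_tail, add_mul,
    Polynomial.coeff_add, hX', Polynomial.coeff_C_mul, h₁, mul_one, mul_add, sub_eq_iff_eq_add,
    add_left_comm, ← mul_add, ← map_add, add_neg_cancel, map_zero, mul_zero, add_zero]
  split_ifs
  · rw [evalMap_coeffMap_rightMul hρ hr]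
  · rw [map_zero, mul_zero]

theorem evalMap_freeAct (hρ : StrictMono ρ) (hr : IsRankFunction ρ) (ho : ∀ v : P, o ≤ v)
    (a : FreeAlgebra F (HasseEdge P)) (x : Word ρ →₀ F) :
    evalMap F ρ ho ((freeAct hρ a).unop x) =
      evalMap F ρ ho x * RingQuot.mkAlgHom F (Rel F P) a := by
  induction a using FreeAlgebra.induction generalizing x with
  | grade0 c =>
    rw [AlgHom.commutes, AlgHom.commutes, MulOpposite.algebraMap_apply, MulOpposite.unop_op,
      Module.algebraMap_end_apply, map_smul, ← Algebra.commutes, Algebra.smul_def]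
  | grade1 e => rw [freeAct_ι, MulOpposite.unop_op, evalMap_edgeMul hρ hr]
  | mul a b ha hb =>
    rw [map_mul, MulOpposite.unop_mul, Module.End.mul_apply, hb, ha, map_mul, mul_assoc]
  | add a b ha hb =>
    rw [map_add, MulOpposite.unop_add, LinearMap.add_apply, map_add, ha, hb, map_add, mul_add]

/-- Appending an allowed letter needs no reduction, so a normal word applied to the empty word
spells itself. This gives linear independence. -/
theorem act_evalWord (hρ : StrictMono ρ) (hr : IsRankFunction ρ) (ho : ∀ v : P, o ≤ v)
    (w : Word ρ) : (act F hρ hr (evalWord F ho w)).unop (Finsupp.single Word.nil 1) =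
      Finsupp.single w 1 := by
  induction w using Word.induction with
  | nil => simp [evalWord_nil]
  | snoc w v h j ih =>
    rw [evalWord_snoc, map_mul, MulOpposite.unop_mul, Module.End.mul_apply, ih, vertexPoly_coeff,
      act_coeff_edgePoly hρ hr (isPath_pathToLeast ho v) fun v _ => ho v,
      rightMul_single_of_good hρ h, coeffMap_monicPoly_fin]

theorem evalMap_injective (hρ : StrictMono ρ) (hr : IsRankFunction ρ) (ho : ∀ v : P, o ≤ v) :
    Function.Injective (evalMap F ρ ho) := by
  refine Function.LeftInverse.injective
    (g := fun a => (act F hρ hr a).unop (Finsupp.single Word.nil 1)) fun x => ?_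
  induction x using Finsupp.induction_linear with
  | zero => simp
  | add x y hx hy =>
    dsimp only at hx hy ⊢
    rw [map_add, map_add, MulOpposite.unop_add, LinearMap.add_apply, hx, hy]
  | single w c =>
    dsimp only
    rw [← Finsupp.smul_single_one, map_smul, map_smul, MulOpposite.unop_smul,
      LinearMap.smul_apply, evalMap_single, act_evalWord hρ hr]

end Evaluation

/-! ### The grading and the basis -/

section Degree

theorem edgePoly_coeff_mem (es : List (HasseEdge P)) (i m : ℕ) (h : i + m = es.length) :
    (edgePoly F es).coeff i ∈ freeDegree F P m := by
  induction es generalizing i m with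
  | nil =>
    obtain ⟨rfl, rfl⟩ : i = 0 ∧ m = 0 := by simpa using h
    simp [edgePoly, freeDegree]
  | cons e es ih =>
    rw [List.length_cons] at h
    have hX := Polynomial.coeff_X_pow_mul' (edgePoly F es) 1 i
    rw [pow_one] at hX
    rw [edgePoly_cons, sub_mul, Polynomial.coeff_sub, hX, Polynomial.coeff_C_mul]
    refine sub_mem ?_ ?_
    · split_ifs
      · exact ih _ _ (by omega)
      · exact zero_mem _
    · rcases m with _ | m
      · rw [coeff_eq_zero_of_natDegree_lt (by rw [edgePoly_natDegree]; omega), mul_zero]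
        exact zero_mem _
      · rw [freeDegree, pow_succ']
        exact Submodule.mul_mem_mul (Submodule.subset_span ⟨e, rfl⟩) (ih _ _ (by omega))

theorem mul_mem_degree {m n : ℕ} {a b : Alg F P} (ha : a ∈ degree F P m) (hb : b ∈ degree F P n) :
    a * b ∈ degree F P (m + n) := by
  obtain ⟨a, ha, rfl⟩ := ha
  obtain ⟨b, hb, rfl⟩ := hb
  refine ⟨a * b, ?_, map_mul (RingQuot.mkAlgHom F (Rel F P)) a b⟩
  rw [SetLike.mem_coe, freeDegree, pow_add]
  exact Submodule.mul_mem_mul ha hb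

theorem freeAct_mem_wordDegree (hρ : StrictMono ρ) (hr : IsRankFunction ρ) {n : ℕ}
    {a : FreeAlgebra F (HasseEdge P)} (ha : a ∈ freeDegree F P n) :
    (freeAct hρ a).unop (Finsupp.single Word.nil 1) ∈ wordDegree F ρ n := by
  induction n generalizing a with
  | zero =>
    rw [freeDegree, pow_zero, Submodule.mem_one] at ha
    obtain ⟨c, rfl⟩ := ha
    rw [AlgHom.commutes, MulOpposite.algebraMap_apply, MulOpposite.unop_op,
      Module.algebraMap_end_apply]
    exact Submodule.smul_mem _ c (Finsupp.single_mem_supported F 1 rfl)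
  | succ n ih =>
    rw [freeDegree, pow_succ] at ha
    refine Submodule.mul_induction_on ha (fun b hb c hc => ?_) fun b c hb hc => ?_
    · rw [map_mul, MulOpposite.unop_mul, Module.End.mul_apply]
      induction hc using Submodule.span_induction with
      | mem c hc =>
        obtain ⟨e, rfl⟩ := hc
        rw [freeAct_ι]
        exact edgeMul_mem_wordDegree hρ hr e (ih hb)
      | zero => simp
      | add c d _ _ hc hd => simpa using add_mem hc hd
      | smul k c _ hc => simpa using Submodule.smul_mem _ k hc
    · rw [map_add, MulOpposite.unop_add, LinearMap.add_apply]
      exact add_mem hb hc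

variable [LocallyFiniteOrder P] {o : P}

theorem evalWord_mem_degree (hr : IsRankFunction ρ) (ho : ∀ v : P, o ≤ v) (w : Word ρ) :
    evalWord F ho w ∈ degree F P w.deg := by
  induction w using Word.induction with
  | nil =>
    rw [evalWord_nil]
    exact ⟨1, by simp [freeDegree], map_one (RingQuot.mkAlgHom F (Rel F P))⟩
  | snoc w v h j ih =>
    have hd : (w.snoc v h j).deg = w.deg + (ρ v - j) := by
      have := w.deg_snoc v h j
      omega
    rw [evalWord_snoc, hd, vertexPoly_coeff]
    refine mul_mem_degree ih ⟨_, edgePoly_coeff_mem _ _ _ ?_, rfl⟩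
    rw [length_pathToLeast hr]
    omega

theorem map_evalMap_wordDegree (hρ : StrictMono ρ) (hr : IsRankFunction ρ) (ho : ∀ v : P, o ≤ v)
    (n : ℕ) : (wordDegree F ρ n).map (evalMap F ρ ho) = degree F P n := by
  apply le_antisymm
  · rw [wordDegree, Finsupp.supported_eq_span_single, Submodule.map_span, Submodule.span_le]
    rintro _ ⟨_, ⟨w, rfl, rfl⟩, rfl⟩
    rw [evalMap_single]
    exact evalWord_mem_degree hr ho w
  · rintro _ ⟨a, ha, rfl⟩
    refine ⟨_, freeAct_mem_wordDegree hρ hr ha, ?_⟩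
    rw [evalMap_freeAct hρ hr, evalMap_single, evalWord_nil, one_mul]
    rfl

/-- The normal words of degree `n` are a basis of the degree `n` component. -/
theorem finrank_degree (hρ : StrictMono ρ) (hr : IsRankFunction ρ) (ho : ∀ v : P, o ≤ v) (n : ℕ) :
    Module.finrank F (degree F P n) = Nat.card {w : Word ρ // w.deg = n} := by
  rw [← map_evalMap_wordDegree hρ hr ho,
    ← (Submodule.equivMapOfInjective _ (evalMap_injective hρ hr ho) _).finrank_eq]
  exact Module.finrank_eq_nat_card_basis (.ofRepr (Finsupp.supportedEquivFinsupp _))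

end Degree

end

/-! ### Generating functions -/

section GenSeries

/-- The generating function `∑ x, z ^ d x` of a type with a degree function. -/
def genSeries {T : Type*} (d : T → ℕ) : ℚ⟦X⟧ :=
  PowerSeries.mk fun n => (Nat.card {x // d x = n} : ℚ)

theorem genSeries_eq_add_sum {W T ι : Type*} [Fintype ι] {S : ι → Type*} (d : W → ℕ)
    (h : ∀ n, Finite {w // d w = n}) (e : T ⊕ (Σ i, S i) ≃ W) :
    genSeries d = genSeries (fun x => d (e (.inl x))) +
      ∑ i, genSeries fun y => d (e (.inr ⟨i, y⟩)) := by
  ext n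
  -- Finiteness matters: `Nat.card` is 0 on infinite types and would not be additive.
  have := h n
  have h₁ : Finite {x // d (e (.inl x)) = n} :=
    Finite.of_injective (β := {w // d w = n}) (fun x => ⟨_, x.2⟩) fun x y hxy =>
      Subtype.ext (Sum.inl_injective (e.injective (congrArg (·.1) hxy)))
  have h₂ : Finite {x // d (e (.inr x)) = n} :=
    Finite.of_injective (β := {w // d w = n}) (fun x => ⟨_, x.2⟩) fun x y hxy =>
      Subtype.ext (Sum.inr_injective (e.injective (congrArg (·.1) hxy)))
  have h₃ (i : ι) : Finite {y // d (e (.inr ⟨i, y⟩)) = n} :=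
    Finite.of_injective (β := {x // d (e (.inr x)) = n}) (fun x => ⟨_, x.2⟩) fun x y hxy =>
      Subtype.ext (sigma_mk_injective (congrArg (·.1) hxy))
  have e₁ : {w // d w = n} ≃ {x // d (e x) = n} := (e.subtypeEquivOfSubtype (p := (d · = n))).symm
  have e₂ : {x // d (e (.inr x)) = n} ≃ Σ i, {y // d (e (.inr ⟨i, y⟩)) = n} :=
    { toFun := fun x => ⟨x.1.1, x.1.2, x.2⟩
      invFun := fun x => ⟨⟨x.1, x.2.1⟩, x.2.2⟩
      left_inv := fun _ => rfl
      right_inv := fun _ => rfl }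
  simp only [map_add, map_sum, genSeries, coeff_mk]
  rw [Nat.card_congr (e₁.trans Equiv.subtypeSum), Nat.card_sum, Nat.card_congr e₂, Nat.card_sigma,
    Nat.cast_add, Nat.cast_sum]

theorem genSeries_add_const {T : Type*} (d : T → ℕ) (c : ℕ) :
    genSeries (fun x => d x + c) = PowerSeries.X ^ c * genSeries d := by
  ext n
  rw [PowerSeries.coeff_X_pow_mul', genSeries, coeff_mk]
  split_ifs with h
  · rw [genSeries, coeff_mk, Nat.card_congr (Equiv.subtypeEquivRight fun x => ?_)]
    omega
  · have : IsEmpty {x // d x + c = n} := ⟨fun x => h (by have := x.2; omega)⟩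
    rw [Nat.card_of_isEmpty, Nat.cast_zero]

end GenSeries

/-! ### Two recursions for normal words -/

section Words

variable {P : Type*} [PartialOrder P] {ρ : P → ℕ}

/-- Every letter has degree at least 1; hence there are finitely many words of each degree. -/
theorem Word.length_le_deg (w : Word ρ) : w.1.length ≤ w.deg := by
  induction w using Word.induction with
  | nil => simp [Word.nil]
  | snoc w v h j ih =>
    have := w.deg_snoc v h j
    have : (w.snoc v h j).1.length = w.1.length + 1 := rfl
    omega

theorem Word.finite_deg [Finite P] (n : ℕ) : Finite {w : Word ρ // w.deg = n} := by
  have := (List.finite_length_le (Letter ρ) n).to_subtype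
  exact Finite.of_injective (β := {l : List (Letter ρ) | l.length ≤ n})
    (fun w => ⟨w.1.1, w.1.length_le_deg.trans_eq w.2⟩)
    fun x y e => Subtype.ext (Subtype.ext (congrArg (·.1) e))

/-- The generating function of the words that may be followed by the letters of `v`. -/
def goodSeries (ρ : P → ℕ) (v : P) : ℚ⟦X⟧ := genSeries fun w : {w : Word ρ // w.Good v} => w.1.deg

/-- A word is good for `v`, or it arises from a word good for some `u > v` by appending the letter
of `u` that blocks `v`. -/
def splitAt (hρ : StrictMono ρ) (v : P) :
    {w : Word ρ // w.Good v} ⊕ (Σ u : {u // v < u}, {w : Word ρ // w.Good u.1}) ≃ Word ρ :=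
  Equiv.ofBijective
    (Sum.elim (fun w => w.1) fun x => x.2.1.snoc x.1.1 x.2.2 ⟨ρ v, hρ x.1.2⟩) <| by
    constructor
    · rintro (⟨w, hw⟩ | ⟨⟨u, hu⟩, w, hw⟩) (⟨w', hw'⟩ | ⟨⟨u', hu'⟩, w', hw'⟩) e
      · obtain rfl : w = w' := e
        rfl
      · obtain rfl : w = w'.snoc u' hw' ⟨ρ v, hρ hu'⟩ := e
        exact absurd ⟨hu', rfl⟩ (Word.good_snoc.1 hw)
      · obtain rfl : w.snoc u hw ⟨ρ v, hρ hu⟩ = w' := e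
        exact absurd ⟨hu, rfl⟩ (Word.good_snoc.1 hw')
      · obtain ⟨rfl, h, -⟩ := Word.snoc_inj (h := hw) (h' := hw') e
        dsimp only at h
        subst h
        rfl
    · intro w
      by_cases h : w.Good v
      · exact ⟨.inl ⟨w, h⟩, rfl⟩
      · obtain ⟨w', u, h', ⟨j, hj'⟩, hv, hj, rfl⟩ := Word.exists_of_not_good h
        obtain rfl : j = ρ v := hj
        exact ⟨.inr ⟨⟨u, hv⟩, w', h'⟩, rfl⟩

/-- A word is empty or arises by appending a letter. -/
def splitLast (ρ : P → ℕ) : Unit ⊕ (Σ a : Letter ρ, {w : Word ρ // w.Good a.1}) ≃ Word ρ :=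
  Equiv.ofBijective (Sum.elim (fun _ => Word.nil) fun x => x.2.1.snoc x.1.1 x.2.2 x.1.2) <| by
    constructor
    · rintro (⟨⟩ | ⟨⟨u, j⟩, w, hw⟩) (⟨⟩ | ⟨⟨u', j'⟩, w', hw'⟩) e
      · rfl
      · exact absurd (congrArg Subtype.val e) (List.cons_ne_nil _ _).symm
      · exact absurd (congrArg Subtype.val e) (List.cons_ne_nil _ _)
      · obtain ⟨h₁, h₂, h₃⟩ := Word.snoc_inj (h := hw) (h' := hw') e
        dsimp only at h₁ h₂ h₃
        subst h₁ h₂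
        obtain rfl := Fin.ext h₃
        rfl
    · intro w
      induction w using Word.induction with
      | nil => exact ⟨.inl (), rfl⟩
      | snoc w v h j _ => exact ⟨.inr ⟨⟨v, j⟩, w, h⟩, rfl⟩

theorem genSeries_deg_eq_sum [Fintype P] [DecidableLE P] (hρ : StrictMono ρ) (v : P) :
    genSeries (Word.deg (ρ := ρ)) =
      ∑ u, if v ≤ u then PowerSeries.X ^ (ρ u - ρ v) * goodSeries ρ u else 0 := by
  classical
  have hd (u : {u // v < u}) (w : {w : Word ρ // w.Good u.1}) :
      (splitAt hρ v (.inr ⟨u, w⟩)).deg = w.1.deg + (ρ u.1 - ρ v) := by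
    have h₁ := w.1.deg_snoc u.1 w.2 ⟨ρ v, hρ u.2⟩
    have h₂ := hρ u.2
    change (w.1.snoc u.1 w.2 ⟨ρ v, hρ u.2⟩).deg = _
    dsimp only at h₁
    omega
  rw [genSeries_eq_add_sum _ Word.finite_deg (splitAt hρ v)]
  simp only [hd, genSeries_add_const]
  rw [← Finset.add_sum_erase _ _ (Finset.mem_univ v), if_pos le_rfl, Nat.sub_self, pow_zero,
    one_mul, ← Finset.sum_filter]
  congr 1
  symm
  apply Finset.sum_subtype _ _ fun u => PowerSeries.X ^ (ρ u - ρ v) * goodSeries ρ u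
  intro u
  simp [lt_iff_le_and_ne, and_comm, eq_comm]

theorem genSeries_deg_eq_one_add [Fintype P] :
    genSeries (Word.deg (ρ := ρ)) =
      1 + ∑ u, ∑ k ∈ Finset.range (ρ u), PowerSeries.X ^ (k + 1) * goodSeries ρ u := by
  have hd (a : Letter ρ) (w : {w : Word ρ // w.Good a.1}) :
      (splitLast ρ (.inr ⟨a, w⟩)).deg = w.1.deg + (ρ a.1 - a.2) := by
    have h₁ := w.1.deg_snoc a.1 w.2 a.2
    change (w.1.snoc a.1 w.2 a.2).deg = _
    omega
  rw [genSeries_eq_add_sum _ Word.finite_deg (splitLast ρ)]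
  simp only [hd, genSeries_add_const]
  congr 1
  · ext n
    rw [genSeries, coeff_mk, PowerSeries.coeff_one]
    change (Nat.card {_x : Unit // 0 = n} : ℚ) = _
    split_ifs with h
    · subst h
      simp
    · have : IsEmpty {_x : Unit // 0 = n} := ⟨fun x => h x.2.symm⟩
      rw [Nat.card_of_isEmpty, Nat.cast_zero]
  · rw [Fintype.sum_sigma]
    refine Finset.sum_congr rfl fun u _ => ?_
    -- The letter `(u, j)` has degree `ρ u - j`; reversing the order of summation matches it with `k
    -- + 1`.
    rw [← Finset.sum_range_reflect, Finset.sum_range]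
    refine Finset.sum_congr rfl fun j _ => ?_
    have : ρ u - 1 - j + 1 = ρ u - j := by omega
    rw [this]
    rfl

end Words

theorem IsRankFunction.prod {P Q : Type*} [PartialOrder P] [PartialOrder Q] {ρ : P → ℕ} {τ : Q → ℕ}
    (hρ : IsRankFunction ρ) (hτ : IsRankFunction τ) :
    IsRankFunction fun x : P × Q => ρ x.1 + τ x.2 where
  eq_zero_iff x := by
    rw [Nat.add_eq_zero_iff, hρ.eq_zero_iff, hτ.eq_zero_iff, ← Prod.isMin_iff]
  covBy x y h := by
    rcases Prod.covBy_iff.1 h with ⟨h, e⟩ | ⟨h, e⟩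
    · rw [hρ.covBy _ _ h, e]
      omega
    · rw [hτ.covBy _ _ h, e]
      omega

theorem IsRankFunction.strictMono {P : Type*} [PartialOrder P] [LocallyFiniteOrder P]
    {ρ : P → ℕ} (hr : IsRankFunction ρ) : StrictMono ρ := by
  intro p q h
  induction transGen_covBy_of_lt h with
  | single hb =>
    rw [hr.covBy _ _ hb]
    exact Nat.lt_succ_self _
  | @tail b c hb hc ih =>
    have := hr.covBy _ _ hc
    have := ih (lt_iff_transGen_covBy.2 hb)
    omega

/-! ### Möbius inversion and the Hilbert series -/

section Mobius

variable {P : Type*} [PartialOrder P] [Fintype P] [DecidableEq P] [LocallyFiniteOrder P] {ρ : P → ℕ}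

theorem mobiusSeries_eq_sum [DecidableLE P] (ρ : P → ℕ) : mobiusSeries ρ = ∑ p, ∑ q,
    if p ≤ q then (IncidenceAlgebra.mu ℤ (α := P) p q : ℚ⟦X⟧) * PowerSeries.X ^ (ρ q - ρ p)
    else 0 := by
  classical
  rw [mobiusSeries, mobiusPolynomial, Polynomial.map_sum, ← Fintype.sum_prod_type', ←
    Polynomial.coeToPowerSeries.ringHom_apply, map_sum, Finset.sum_filter]
  refine Finset.sum_congr rfl fun x _ => ?_
  by_cases h : x.1 ≤ x.2
  · simp only [h, if_true, Polynomial.map_mul, Polynomial.map_pow,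
      Polynomial.map_X, map_mul, map_pow, eq_intCast]
    simp
  · simp [h]

/-- Expanding the series at `q` for each term μ(p, q), the powers of z combine to z^(ρ(u)-ρ(p)), and
the sum of μ(p, q) over p ≤ q ≤ u leaves only u = p. -/
theorem mobiusSeries_mul_genSeries (hρ : StrictMono ρ) :
    mobiusSeries ρ * genSeries (Word.deg (ρ := ρ)) = ∑ p, goodSeries ρ p := by
  classical
  have key (p u : P) : (∑ q, if p ≤ q ∧ q ≤ u then
      (IncidenceAlgebra.mu ℤ (α := P) p q : ℚ⟦X⟧) else 0) = if p = u then 1 else 0 := by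
    have := IncidenceAlgebra.sum_Icc_mu_right (𝕜 := ℤ) p u
    rw [← Finset.sum_filter]
    have h : (Finset.univ.filter fun q => p ≤ q ∧ q ≤ u) = Finset.Icc p u := by ext; simp
    rw [h, ← Int.cast_sum, this]
    split_ifs <;> simp
  have h₁ (p q : P) : (if p ≤ q then (IncidenceAlgebra.mu ℤ (α := P) p q : ℚ⟦X⟧) *
      PowerSeries.X ^ (ρ q - ρ p) else 0) * genSeries (Word.deg (ρ := ρ)) =
      ∑ u, (if p ≤ q ∧ q ≤ u then (IncidenceAlgebra.mu ℤ (α := P) p q : ℚ⟦X⟧) else 0) *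
        (PowerSeries.X ^ (ρ u - ρ p) * goodSeries ρ u) := by
    rw [genSeries_deg_eq_sum hρ q, Finset.mul_sum]
    refine Finset.sum_congr rfl fun u _ => ?_
    by_cases hp : p ≤ q
    · by_cases hq : q ≤ u
      · have : ρ u - ρ p = (ρ q - ρ p) + (ρ u - ρ q) := by
          have := hρ.monotone hp
          have := hρ.monotone hq
          omega
        rw [if_pos hp, if_pos hq, if_pos ⟨hp, hq⟩, this, pow_add]
        ring
      · simp [hq]
    · simp [hp]
  rw [mobiusSeries_eq_sum, Finset.sum_mul]
  refine Finset.sum_congr rfl fun p _ => ?_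
  rw [Finset.sum_mul]
  simp only [h₁]
  rw [Finset.sum_comm]
  simp only [← Finset.sum_mul, key]
  simp

theorem genSeries_mul_one_sub (hρ : StrictMono ρ) (hr : IsRankFunction ρ) {o : P}
    (ho : ∀ v : P, o ≤ v) :
    genSeries (Word.deg (ρ := ρ)) * (1 - PowerSeries.X * mobiusSeries ρ) = 1 - PowerSeries.X := by
  classical
  have h₁ := genSeries_deg_eq_sum hρ o
  have h₂ := genSeries_deg_eq_one_add (ρ := ρ)
  have h₃ := mobiusSeries_mul_genSeries hρ
  simp only [ho, if_true, rank_least hr ho, Nat.sub_zero] at h₁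
  -- The geometric sums telescope; the two sums on the right are then `mobiusSeries ρ * genSeries
  -- Word.deg` and, by the blocking recursion at `o`, `genSeries Word.deg`.
  have h₄ : (1 - PowerSeries.X : ℚ⟦X⟧) *
      ∑ u, ∑ k ∈ Finset.range (ρ u), PowerSeries.X ^ (k + 1) * goodSeries ρ u =
        PowerSeries.X * ∑ u, goodSeries ρ u -
          PowerSeries.X * ∑ u, PowerSeries.X ^ ρ u * goodSeries ρ u := by
    simp only [Finset.mul_sum, ← Finset.sum_sub_distrib]
    refine Finset.sum_congr rfl fun u _ => ?_
    have := mul_neg_geom_sum (PowerSeries.X : ℚ⟦X⟧) (ρ u)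
    rw [← Finset.mul_sum]
    simp only [pow_succ', mul_assoc]
    rw [← Finset.mul_sum, ← Finset.sum_mul]
    linear_combination (PowerSeries.X * goodSeries ρ u) * this
  rw [← h₁, ← h₃] at h₄
  linear_combination (1 - PowerSeries.X : ℚ⟦X⟧) * h₂ + h₄

/-- The Hilbert series of the splitting algebra of a ranked poset with a least element. -/
theorem hilbertSeries_mul_one_sub (F : Type*) [Field F] (hr : IsRankFunction ρ) {o : P}
    (ho : ∀ v : P, o ≤ v) :
    hilbertSeries F P * (1 - PowerSeries.X * mobiusSeries ρ) = 1 - PowerSeries.X := by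
  have h : hilbertSeries F P = genSeries (Word.deg (ρ := ρ)) := by
    ext n
    rw [hilbertSeries, genSeries, coeff_mk, coeff_mk, finrank_degree hr.strictMono hr ho]
  rw [h, genSeries_mul_one_sub hr.strictMono hr ho]

variable {Q : Type*} [PartialOrder Q] [Fintype Q] [DecidableEq Q] [LocallyFiniteOrder Q] {τ : Q → ℕ}

theorem mobiusSeries_prod [DecidableLE P] [DecidableLE Q] (hρ : StrictMono ρ) (hτ : StrictMono τ) :
    mobiusSeries (fun x : P × Q => ρ x.1 + τ x.2) = mobiusSeries ρ * mobiusSeries τ := by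
  rw [mobiusSeries_eq_sum, mobiusSeries_eq_sum, mobiusSeries_eq_sum, Fintype.sum_prod_type,
    Finset.sum_mul_sum]
  refine Finset.sum_congr rfl fun p _ => Finset.sum_congr rfl fun p' _ => ?_
  rw [Fintype.sum_prod_type, Finset.sum_mul_sum]
  refine Finset.sum_congr rfl fun q _ => Finset.sum_congr rfl fun q' _ => ?_
  by_cases h : p ≤ q
  · by_cases h' : p' ≤ q'
    · have := hρ.monotone h
      have := hτ.monotone h'
      have e : ρ q + τ q' - (ρ p + τ p') = (ρ q - ρ p) + (τ q' - τ p') := by omega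
      have hmu : IncidenceAlgebra.mu ℤ (p, p') (q, q') =
          IncidenceAlgebra.mu ℤ p q * IncidenceAlgebra.mu ℤ p' q' := by
        rw [← IncidenceAlgebra.mu_prod_mu, IncidenceAlgebra.prod_mk]
      rw [if_pos (Prod.mk_le_mk.2 ⟨h, h'⟩), if_pos h, if_pos h', hmu, e, Int.cast_mul, pow_add]
      ring
    · simp [h']
  · simp [h]

/-- In a finite poset every element lies above a minimal one, so a unique minimal element is least.
-/
theorem exists_forall_le {R : Type*} [PartialOrder R] [Finite R] (h : ∃! p : R, IsMin p) :
    ∃ o : R, ∀ v, o ≤ v := by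
  obtain ⟨o, -, ho⟩ := h
  refine ⟨o, fun v => ?_⟩
  obtain ⟨m, hm, hmin⟩ := exists_minimal_le_of_wellFoundedLT (fun _ => True) v trivial
  exact ho m (minimal_true.1 hmin) ▸ hm

end Mobius

end SplittingAlgebra

end

theorem mainTheorem7 (F : Type*) [Field F]
    (P : Type*) [PartialOrder P] [Fintype P] [DecidableEq P] [LocallyFiniteOrder P]
    (Q : Type*) [PartialOrder Q] [Fintype Q] [DecidableEq Q] [LocallyFiniteOrder Q]
    (hP : ∃! p : P, IsMin p) (hQ : ∃! q : Q, IsMin q)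
    (ρ : P → ℕ) (hρ : SplittingAlgebra.IsRankFunction ρ)
    (τ : Q → ℕ) (hτ : SplittingAlgebra.IsRankFunction τ) :
    SplittingAlgebra.hilbertSeries F (P × Q) =
      (1 - PowerSeries.X) *
        (1 - PowerSeries.X * SplittingAlgebra.mobiusSeries ρ *
          SplittingAlgebra.mobiusSeries τ)⁻¹ := by
  classical
  obtain ⟨o, ho⟩ := SplittingAlgebra.exists_forall_le hP
  obtain ⟨o', ho'⟩ := SplittingAlgebra.exists_forall_le hQ
  -- The denominator has constant coefficient 1, so its power series inverse is genuine.
  rw [PowerSeries.eq_mul_inv_iff_mul_eq (by simp), mul_assoc,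
    ← SplittingAlgebra.mobiusSeries_prod hρ.strictMono hτ.strictMono]
  exact SplittingAlgebra.hilbertSeries_mul_one_sub F (hρ.prod hτ) (o := (o, o'))
    fun v => ⟨ho v.1, ho' v.2⟩
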